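/- Let $\mathcal P$ be the set of Borel probability distributions on $[0,1]$. For $P\in\mathcal P$ let $\tilde v\sim P$, and put $\bar P(x)=\mathbb P(\tilde v>x)$ and $\mathcal R_P(x)=x\,\mathbb P(\tilde v\ge x)$ for $x\in[0,1]$. Fix a reference distribution $P_0\in\mathcal P$ and a target $\tau>0$. Let $d(P,P_0)=\int_0^1|\bar P(x)-\bar P_0(x)|\,\mathrm dx$ be the type-1 Wasserstein distance, and let $\mathcal M$ be the set of direct mechanisms $(q,m):[0,1]\to[0,1]\times\mathbb R$ that satisfy $q(v)v-m(v)\ge 0$ and $q(v)v-m(v)\ge q(w)v-m(w)$ for all $v,w\in[0,1]$. The robust satisficing problem is $$\inf_{(q,m)\in\mathcal M,\;k>0} k\quad\text{s.t.}\quad \tau-\mathbb E_P[m(\tilde v)]\le k\,d(P,P_0)\quad\forall P\in\mathcal P. \tag{RS}$$ Let $\Pi_0=\max_{x\in[0,1]}\mathcal R_{P_0}(x)$ and, for $\pi\ge 0$, $d(\pi)=\int_0^1\left(\bar P_0(x)-\pi/x\right)^+\mathrm dx$. Then (RS) is equivalent to $$\inf_{k>0} k\quad\text{s.t.}\quad \tau\le\min_{\pi\in[0,\Pi_0]}\left[\pi+k\,d(\pi)\right],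 \tag{R}$$ in the following sense. The maximum defining $\Pi_0$ is attained, and for every $k>0$ the minimum in (R) is attained. For every $k$, there is $(q,m)\in\mathcal M$ such that $(q,m,k)$ is feasible for (RS) if and only if $k$ is feasible for (R). Hence (RS) and (R) have the same optimal value in $[0,+\infty]$ (with $\inf\emptyset=+\infty$), and $k$ is the $k$-component of an optimal solution of (RS) if and only if $k$ is an optimal solution of (R). -/

import Mathlib

open Set MeasureTheory
open scoped unitInterval

namespace RobustScreening

noncomputable section

/-- Direct mechanisms `(q, m) : [0,1] → [0,1] × ℝ` that are individually rational and
incentive compatible. -/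
def mechanisms : Set ((I → I) × (I → ℝ)) :=
  {M | (∀ v : I, 0 ≤ (M.1 v : ℝ) * v - M.2 v) ∧
       ∀ v w : I, (M.1 w : ℝ) * v - M.2 w ≤ (M.1 v : ℝ) * v - M.2 v}

/-- The complementary cumulative distribution function `P(ṽ > x)` of a distribution on `[0,1]`. -/
def ccdf (P : ProbabilityMeasure I) (x : ℝ) : ℝ :=
  (P : Measure I).real {v : I | x < (v : ℝ)}

/-- The type-1 Wasserstein distance: the integral over `[0,1]` of the absolute difference of the
complementary cumulative distribution functions. -/
def wassersteinDist (P P₀ : ProbabilityMeasure I) : ℝ :=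
  ∫ x in (0 : ℝ)..1, |ccdf P x - ccdf P₀ x|

/-- The expected payment `E_P[m(ṽ)]`.  (For an incentive compatible mechanism `m` is monotone,
hence bounded and Borel, so that the integral always exists.) -/
def expectedRevenue (P : ProbabilityMeasure I) (m : I → ℝ) : ℝ :=
  ∫ v, m v ∂(P : Measure I)

/-- Expected revenue `x · P(ṽ ≥ x)` of the posted price `x`. -/
def postedRevenue (P : ProbabilityMeasure I) (x : I) : ℝ :=
  (x : ℝ) * (P : Measure I).real {v : I | x ≤ v}

/-- The optimal posted-price revenue. -/
def maxPostedRevenue (P : ProbabilityMeasure I) : ℝ :=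
  ⨆ x : I, postedRevenue P x

/-- `d(π) = ∫₀¹ (P̄₀(x) - π/x)⁺ dx`. -/
def isoDist (P₀ : ProbabilityMeasure I) (π : ℝ) : ℝ :=
  ∫ x in (0 : ℝ)..1, max (ccdf P₀ x - π / x) 0

/-- The values `π + k · d(π)` for `π ∈ [0, Π₀]`. -/
def adjustedRevenues (P₀ : ProbabilityMeasure I) (k : ℝ) : Set ℝ :=
  (fun π : ℝ => π + k * isoDist P₀ π) '' Icc 0 (maxPostedRevenue P₀)

/-- The minimum of `π + k · d(π)` over `π ∈ [0, Π₀]`. -/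
def minAdjustedRevenue (P₀ : ProbabilityMeasure I) (k : ℝ) : ℝ :=
  sInf (adjustedRevenues P₀ k)

/-- Feasible points `((q, m), k)` of the robust satisficing problem with target `τ`. -/
def satisficingFeasible (P₀ : ProbabilityMeasure I) (τ : ℝ) :
    Set (((I → I) × (I → ℝ)) × ℝ) :=
  {s | s.1 ∈ mechanisms ∧ 0 < s.2 ∧
    ∀ P : ProbabilityMeasure I, τ - expectedRevenue P s.1.2 ≤ s.2 * wassersteinDist P P₀}

/-- Feasible points `k` of the reduced problem with target `τ`. -/
def reducedFeasible (P₀ : ProbabilityMeasure I) (τ : ℝ) : Set ℝ :=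
  {k | 0 < k ∧ τ ≤ minAdjustedRevenue P₀ k}

/-- Optimal value of the robust satisficing problem (`⊤` if it is infeasible). -/
def satisficingValue (P₀ : ProbabilityMeasure I) (τ : ℝ) : EReal :=
  ⨅ s ∈ satisficingFeasible P₀ τ, ((s.2 : ℝ) : EReal)

/-- Optimal value of the reduced problem (`⊤` if it is infeasible). -/
def reducedValue (P₀ : ProbabilityMeasure I) (τ : ℝ) : EReal :=
  ⨅ k ∈ reducedFeasible P₀ τ, (k : EReal)

end

end RobustScreening

open RobustScreening

open Filter Topology

namespace RobustScreening

/-! Fix `k`; the claim is a minimax duality. Against any mechanism, nature may cut the reference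
survival function down to `min (ccdf P₀ x) (π / x)`. Every posted price then earns at most `π`,
hence so does every mechanism (`expectedRevenue_le`), and the cut lies at distance `isoDist P₀ π`;
so (RS) forces the constraint of (R) (`le_adjustedRevenue`).

Conversely, a random posted price with density `g x / x` earns `∫ g · ccdf P`, which is
`k`-Lipschitz in the Wasserstein distance when `0 ≤ g ≤ k`. It thus suffices that `∫ g · ccdf P₀ ≥
τ` for some such `g` with `∫ g x / x ≤ 1`. This is a continuous knapsack problem, solved by a
threshold on `x * ccdf P₀ x`; the threshold `π` is the multiplier, and complementary slackness gives
the value `π + k * isoDist P₀ π` (`exists_knapsack_solution`). -/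

lemma measurableSet_lt_coe (x : ℝ) : MeasurableSet {v : I | x < (v : ℝ)} :=
  measurableSet_lt measurable_const measurable_subtype_coe

lemma ccdf_nonneg (P : ProbabilityMeasure I) (x : ℝ) : 0 ≤ ccdf P x := measureReal_nonneg

lemma ccdf_le_one (P : ProbabilityMeasure I) (x : ℝ) : ccdf P x ≤ 1 := measureReal_le_one

lemma ccdf_antitone (P : ProbabilityMeasure I) : Antitone (ccdf P) := fun _ _ h =>
  measureReal_mono (fun _ hv => lt_of_le_of_lt h hv)

lemma ccdf_measurable (P : ProbabilityMeasure I) : Measurable (ccdf P) :=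
  (ccdf_antitone P).measurable

lemma ccdf_of_one_le (P : ProbabilityMeasure I) {x : ℝ} (hx : 1 ≤ x) : ccdf P x = 0 := by
  have : {v : I | x < (v : ℝ)} = ∅ := by
    ext v
    simpa using v.2.2.trans hx
  simp [ccdf, this]

lemma intervalIntegrable_of_abs_le {f : ℝ → ℝ} (hf : Measurable f) {C : ℝ}
    (hC : ∀ x, |f x| ≤ C) (a b : ℝ) : IntervalIntegrable f volume a b := by
  rw [intervalIntegrable_iff]
  exact Measure.integrableOn_of_bounded (M := C) (by simp) hf.aestronglyMeasurable
    (ae_of_all _ fun x => by simpa using hC x)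

/-! ### Attainment of the two extrema -/

/-- The tail `P(ṽ ≥ x)` is decreasing and left-continuous, so its jumps are all downwards to the
right. Together with compactness this gives an optimal price. -/
lemma postedRevenue_upperSemicontinuous (P : ProbabilityMeasure I) :
    UpperSemicontinuous (postedRevenue P) := by
  intro x₀ y hy
  have hcont : Tendsto (fun c : ℝ => (x₀ : ℝ) * c)
      (𝓝[>] ((P : Measure I).real {v : I | x₀ ≤ v})) (𝓝 (postedRevenue P x₀)) :=
    ((continuous_const.mul continuous_id).tendsto _).mono_left nhdsWithin_le_nhds
  obtain ⟨c, hcy, hc⟩ := ((hcont.eventually (gt_mem_nhds hy)).and self_mem_nhdsWithin).exists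
  have htend : Tendsto (fun n : ℕ => (P : Measure I) {v : I | (x₀ : ℝ) - 1 / (n + 1) ≤ v}) atTop
      (𝓝 ((P : Measure I) (⋂ n : ℕ, {v : I | (x₀ : ℝ) - 1 / (n + 1) ≤ v}))) := by
    apply tendsto_measure_iInter_atTop
    · exact fun n =>
        (measurableSet_le measurable_const measurable_subtype_coe).nullMeasurableSet
    · intro n m hnm v hv
      have := Nat.one_div_le_one_div (α := ℝ) hnm
      simp only [mem_ofPred_eq] at hv ⊢
      linarith
    · exact ⟨0, measure_ne_top _ _⟩
  have hset : (⋂ n : ℕ, {v : I | (x₀ : ℝ) - 1 / (n + 1) ≤ v}) = {v : I | x₀ ≤ v} := by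
    ext v
    simp only [mem_iInter, mem_ofPred_eq, ← Subtype.coe_le_coe]
    constructor
    · intro h
      refine le_of_forall_pos_lt_add fun ε hε => ?_
      obtain ⟨n, hn⟩ := exists_nat_one_div_lt hε
      linarith [h n]
    · intro h n
      have : (0 : ℝ) < 1 / ((n : ℝ) + 1) := by positivity
      linarith
  rw [hset] at htend
  have htend' := (ENNReal.tendsto_toReal (measure_ne_top _ _)).comp htend
  obtain ⟨n, hn⟩ := (htend'.eventually (gt_mem_nhds hc)).exists
  have hpos : (0 : ℝ) < 1 / ((n : ℝ) + 1) := by positivity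
  have h1 : ∀ᶠ x : I in 𝓝 x₀, (x₀ : ℝ) - 1 / (n + 1) < x :=
    continuous_subtype_val.continuousAt.eventually (lt_mem_nhds (by linarith))
  have h2 : ∀ᶠ x : I in 𝓝 x₀, (x : ℝ) * c < y :=
    (continuous_subtype_val.mul continuous_const).continuousAt.eventually (gt_mem_nhds hcy)
  filter_upwards [h1, h2] with x hx1 hx2
  refine lt_of_le_of_lt (mul_le_mul_of_nonneg_left ?_ x.2.1) hx2
  refine le_trans ?_ (le_of_lt hn)
  exact measureReal_mono fun v (hv : x ≤ v) => by
    have : (x : ℝ) ≤ v := hv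
    simp only [mem_ofPred_eq]
    linarith

lemma isGreatest_maxPostedRevenue (P : ProbabilityMeasure I) :
    IsGreatest (range (postedRevenue P)) (maxPostedRevenue P) := by
  obtain ⟨x, -, hx⟩ := ((postedRevenue_upperSemicontinuous P).upperSemicontinuousOn
    univ).exists_isMaxOn univ_nonempty isCompact_univ
  have hg : IsGreatest (range (postedRevenue P)) (postedRevenue P x) :=
    ⟨mem_range_self x, by rintro _ ⟨y, rfl⟩; exact hx (mem_univ y)⟩
  have : maxPostedRevenue P = postedRevenue P x := hg.csSup_eq
  rwa [this]

lemma maxPostedRevenue_nonneg (P : ProbabilityMeasure I) : 0 ≤ maxPostedRevenue P := by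
  have h := (isGreatest_maxPostedRevenue P).2 (mem_range_self 0)
  simpa [postedRevenue] using h

lemma mul_ccdf_le_maxPostedRevenue (P : ProbabilityMeasure I) {x : ℝ} (hx : x ∈ Icc (0 : ℝ) 1) :
    x * ccdf P x ≤ maxPostedRevenue P := by
  refine le_trans ?_ ((isGreatest_maxPostedRevenue P).2 (mem_range_self ⟨x, hx⟩))
  refine mul_le_mul_of_nonneg_left (measureReal_mono fun v hv => ?_) hx.1
  exact le_of_lt (α := ℝ) hv

lemma isoDist_integrand_measurable (P : ProbabilityMeasure I) (π : ℝ) :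
    Measurable fun x : ℝ => max (ccdf P x - π / x) 0 :=
  ((ccdf_measurable P).sub (measurable_const.div measurable_id)).max measurable_const

/-- Dominated convergence: for `π ≥ 0` the integrand is at most `1`, whereas for `π < 0` it blows up
like `1 / x` at the origin. -/
lemma isoDist_continuousOn (P : ProbabilityMeasure I) : ContinuousOn (isoDist P) (Ici 0) := by
  intro π₀ _
  refine intervalIntegral.continuousWithinAt_of_dominated_interval (bound := fun _ => 1) ?_ ?_ ?_ ?_
  · exact Eventually.of_forall fun π => (isoDist_integrand_measurable P π).aestronglyMeasurable
  · filter_upwards [self_mem_nhdsWithin] with π hπ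
    refine ae_of_all _ fun x hx => ?_
    rw [uIoc_of_le zero_le_one] at hx
    have h1 : 0 ≤ π / x := div_nonneg hπ hx.1.le
    rw [Real.norm_of_nonneg (le_max_right _ _)]
    exact max_le (by linarith [ccdf_le_one P x]) zero_le_one
  · exact intervalIntegrable_const
  · refine ae_of_all _ fun x _ => Continuous.continuousWithinAt ?_
    fun_prop

lemma isLeast_minAdjustedRevenue (P : ProbabilityMeasure I) (k : ℝ) :
    IsLeast (adjustedRevenues P k) (minAdjustedRevenue P k) := by
  have hc : IsCompact (adjustedRevenues P k) := by
    refine isCompact_Icc.image_of_continuousOn ?_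
    exact continuousOn_id.add (continuousOn_const.mul
      ((isoDist_continuousOn P).mono Icc_subset_Ici_self))
  refine hc.isLeast_sInf ?_
  exact ⟨_, mem_image_of_mem _ (left_mem_Icc.2 (maxPostedRevenue_nonneg P))⟩

/-! ### Revenue bound for incentive compatible mechanisms -/

lemma allocation_monotone {M : (I → I) × (I → ℝ)} (hM : M ∈ mechanisms) : Monotone M.1 := by
  intro w v hwv
  rcases hwv.eq_or_lt with rfl | hlt
  · rfl
  have h1 := hM.2 v w
  have h2 := hM.2 w v
  have hlt' : (0 : ℝ) < v - w := sub_pos.2 hlt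
  have : 0 ≤ ((M.1 v : ℝ) - M.1 w) * (v - w) := by linarith
  exact Subtype.coe_le_coe.1 (sub_nonneg.1 (nonneg_of_mul_nonneg_left this hlt'))

lemma payment_monotone {M : (I → I) × (I → ℝ)} (hM : M ∈ mechanisms) : Monotone M.2 := by
  intro w v hwv
  have h2 := hM.2 w v
  have h3 : (M.1 w : ℝ) ≤ M.1 v := allocation_monotone hM hwv
  nlinarith [w.2.1]

lemma payment_sub_le {M : (I → I) × (I → ℝ)} (hM : M ∈ mechanisms) (v w : I) :
    M.2 v - M.2 w ≤ v * ((M.1 v : ℝ) - M.1 w) := by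
  linarith [hM.2 v w]

lemma payment_zero_nonpos {M : (I → I) × (I → ℝ)} (hM : M ∈ mechanisms) : M.2 0 ≤ 0 := by
  simpa using hM.1 0

lemma payment_integrable {M : (I → I) × (I → ℝ)} (hM : M ∈ mechanisms) (P : ProbabilityMeasure I) :
    Integrable M.2 (P : Measure I) := by
  have hm := payment_monotone hM
  refine Integrable.of_mem_Icc (M.2 0) (M.2 1) hm.measurable.aemeasurable (ae_of_all _ fun v => ?_)
  exact ⟨hm v.2.1, hm v.2.2⟩

/-- No mechanism earns more than the best posted price. -/
lemma expectedRevenue_le {M : (I → I) × (I → ℝ)} (hM : M ∈ mechanisms) (P : ProbabilityMeasure I)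
    {π : ℝ} (hπ : ∀ x ∈ Icc (0 : ℝ) 1, x * ccdf P x ≤ π) : expectedRevenue P M.2 ≤ π := by
  refine le_of_forall_pos_le_add fun ε hε => ?_
  have hπ0 : 0 ≤ π := by simpa using hπ 0 (by simp)
  obtain ⟨N, hN⟩ := exists_nat_one_div_lt hε
  set n := N + 1 with hn
  have hn0 : (0 : ℝ) < n := by positivity
  have hNε : 1 / (n : ℝ) < ε := by simpa [hn] using hN
  let p : ℕ → I := fun j => projIcc 0 1 zero_le_one ((j : ℝ) / n)
  have hp : ∀ j ≤ n, (p j : ℝ) = (j : ℝ) / n := by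
    intro j hj
    have : ((j : ℝ) / n) ∈ Icc (0 : ℝ) 1 :=
      ⟨by positivity, (div_le_one hn0).2 (by exact_mod_cast hj)⟩
    simp only [p, projIcc_of_mem zero_le_one this]
  have hpm : Monotone p := fun i j hij => monotone_projIcc _ (by gcongr)
  have hp0 : p 0 = 0 := by
    apply Subtype.ext
    simp [hp 0 (Nat.zero_le _)]
  let Δ : ℕ → ℝ := fun j => M.2 (p (j + 1)) - M.2 (p j)
  -- Round `v` up to the next point of the grid `j / n` and telescope the payment; integrating then
  -- turns the indicators into values of the survival function.
  have hpt : ∀ v : I, M.2 v ≤ M.2 0 +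
      ∑ j ∈ Finset.range n, {v : I | (j : ℝ) / n < v}.indicator (fun _ => Δ j) v := by
    intro v
    set i := ⌈(v : ℝ) * n⌉₊ with hi
    have hin : i ≤ n := by
      rw [hi, Nat.ceil_le]
      exact mul_le_of_le_one_left hn0.le v.2.2
    have hvi : v ≤ p i := by
      rw [← Subtype.coe_le_coe, hp i hin, le_div_iff₀ hn0]
      exact Nat.le_ceil _
    have hsum : ∑ j ∈ Finset.range n, {v : I | (j : ℝ) / n < v}.indicator (fun _ => Δ j) v
        = ∑ j ∈ Finset.range i, Δ j := by
      symm
      refine Finset.sum_subset_zero_on_sdiff (Finset.range_mono hin) ?_ ?_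
      · intro j hj
        simp only [Finset.mem_sdiff, Finset.mem_range, not_lt] at hj
        refine indicator_of_notMem ?_ _
        simp only [mem_ofPred_eq, not_lt]
        rw [le_div_iff₀ hn0]
        exact Nat.ceil_le.1 hj.2
      · intro j hj
        rw [indicator_of_mem]
        simp only [mem_ofPred_eq]
        rw [div_lt_iff₀ hn0]
        exact Nat.lt_ceil.1 (Finset.mem_range.1 hj)
    rw [hsum, Finset.sum_range_sub (fun j => M.2 (p j)), hp0]
    linarith [payment_monotone hM hvi]
  have hint : ∀ j ∈ Finset.range n, Integrable
      (fun v : I => {v : I | (j : ℝ) / n < v}.indicator (fun _ => Δ j) v) (P : Measure I) :=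
    fun j _ => (integrable_const _).indicator (measurableSet_lt_coe _)
  have h1 : expectedRevenue P M.2 ≤ M.2 0 + ∑ j ∈ Finset.range n, ccdf P ((j : ℝ) / n) * Δ j := by
    calc expectedRevenue P M.2 ≤ ∫ v, (M.2 0 + ∑ j ∈ Finset.range n,
          {v : I | (j : ℝ) / n < v}.indicator (fun _ => Δ j) v) ∂(P : Measure I) :=
        integral_mono (payment_integrable hM P)
          ((integrable_const _).add (integrable_finsetSum _ hint)) hpt
      _ = _ := by
        rw [integral_add (integrable_const _) (integrable_finsetSum _ hint),
          integral_finsetSum _ hint]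
        simp [integral_indicator_const _ (measurableSet_lt_coe _), ccdf]
  -- The payment increment carries the upper grid point `(j + 1) / n`, the survival function the
  -- lower one; the mismatch `1 / n` is absorbed by `ε`.
  have h2 : ∀ j ∈ Finset.range n, ccdf P ((j : ℝ) / n) * Δ j
      ≤ (π + ε) * ((M.1 (p (j + 1)) : ℝ) - M.1 (p j)) := by
    intro j hj
    have hj' := Finset.mem_range.1 hj
    have hq : (0 : ℝ) ≤ (M.1 (p (j + 1)) : ℝ) - M.1 (p j) :=
      sub_nonneg.2 (allocation_monotone hM (hpm (Nat.le_succ j)))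
    have hΔ : Δ j ≤ ((j : ℝ) / n + 1 / n) * ((M.1 (p (j + 1)) : ℝ) - M.1 (p j)) := by
      have := payment_sub_le hM (p (j + 1)) (p j)
      rw [hp (j + 1) hj'] at this
      convert this using 2
      push_cast
      ring
    have hc := ccdf_nonneg P ((j : ℝ) / n)
    have hc1 := ccdf_le_one P ((j : ℝ) / n)
    have hr := hπ ((j : ℝ) / n) ⟨by positivity, (div_le_one hn0).2 (by exact_mod_cast hj'.le)⟩
    have hn1 : 1 / (n : ℝ) * ccdf P ((j : ℝ) / n) ≤ 1 / n :=
      mul_le_of_le_one_right (by positivity) hc1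
    calc ccdf P ((j : ℝ) / n) * Δ j
        ≤ ccdf P ((j : ℝ) / n) * (((j : ℝ) / n + 1 / n) *
            ((M.1 (p (j + 1)) : ℝ) - M.1 (p j))) := mul_le_mul_of_nonneg_left hΔ hc
      _ = (ccdf P ((j : ℝ) / n) * ((j : ℝ) / n + 1 / n)) *
            ((M.1 (p (j + 1)) : ℝ) - M.1 (p j)) := by ring
      _ ≤ _ := mul_le_mul_of_nonneg_right (by linarith) hq
  have h3 := Finset.sum_le_sum h2
  rw [← Finset.mul_sum, Finset.sum_range_sub (fun j => (M.1 (p j) : ℝ))] at h3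
  have h4 : (M.1 (p n) : ℝ) - M.1 (p 0) ≤ 1 := by linarith [(M.1 (p n)).2.2, (M.1 (p 0)).2.1]
  have h5 : (π + ε) * ((M.1 (p n) : ℝ) - M.1 (p 0)) ≤ π + ε :=
    mul_le_of_le_one_right (by positivity) h4
  linarith [payment_zero_nonpos hM]

/-! ### Worst-case distributions -/

/-- Distributions on `[0,1]` whose survival function is prescribed by a Stieltjes function. -/
lemma exists_ccdf_eq (F : StieltjesFunction ℝ) (hbot : Tendsto F atBot (𝓝 0))
    (htop : Tendsto F atTop (𝓝 1)) :
    ∃ P : ProbabilityMeasure I, ∀ x ∈ Ico (0 : ℝ) 1, ccdf P x = 1 - F x := by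
  have := F.isProbabilityMeasure hbot htop
  have hm : Measurable (projIcc (0 : ℝ) 1 zero_le_one) := continuous_projIcc.measurable
  refine ⟨⟨F.measure.map (projIcc 0 1 zero_le_one), Measure.isProbabilityMeasure_map
    hm.aemeasurable⟩, fun x hx => ?_⟩
  have hset : (projIcc (0 : ℝ) 1 zero_le_one) ⁻¹' {v : I | x < (v : ℝ)} = Ioi x := by
    ext v
    simp only [mem_preimage, mem_ofPred_eq, coe_projIcc, mem_Ioi]
    constructor
    · intro h
      rcases lt_max_iff.1 h with h | h
      · exact absurd h (not_lt.2 hx.1)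
      · exact (lt_min_iff.1 h).2
    · intro h
      exact lt_max_of_lt_right (lt_min hx.2 h)
  have hF : F x ≤ 1 := F.mono.ge_of_tendsto htop x
  simp only [ccdf, ProbabilityMeasure.coe_mk, Measure.real,
    Measure.map_apply hm (measurableSet_lt_coe x), hset, F.measure_Ioi htop]
  exact ENNReal.toReal_ofReal (sub_nonneg.2 hF)

lemma exists_cdf_eq (P : ProbabilityMeasure I) :
    ∃ F : StieltjesFunction ℝ, Tendsto F atBot (𝓝 0) ∧ Tendsto F atTop (𝓝 1) ∧
      ∀ x, ccdf P x = 1 - F x := by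
  have hm : Measurable ((↑) : I → ℝ) := measurable_subtype_coe
  have := Measure.isProbabilityMeasure_map (μ := (P : Measure I)) hm.aemeasurable
  refine ⟨ProbabilityTheory.cdf ((P : Measure I).map (↑)), ProbabilityTheory.tendsto_cdf_atBot _,
    ProbabilityTheory.tendsto_cdf_atTop _, fun x => ?_⟩
  rw [ProbabilityTheory.cdf_eq_real, ← probReal_compl_eq_one_sub measurableSet_Iic, compl_Iic,
    map_measureReal_apply hm measurableSet_Ioi]
  rfl

lemma exists_ccdf_eq_min (P₀ : ProbabilityMeasure I) {π : ℝ} (hπ : 0 < π) :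
    ∃ P : ProbabilityMeasure I, ∀ x ∈ Ioc (0 : ℝ) 1, ccdf P x = min (ccdf P₀ x) (π / x) := by
  obtain ⟨F, hbot, htop, hF⟩ := exists_cdf_eq P₀
  have hmax : ∀ x, 0 < max x π := fun x => lt_max_of_lt_right hπ
  have hcont : Continuous fun x : ℝ => 1 - π / max x π :=
    continuous_const.sub (continuous_const.div (continuous_id.max continuous_const)
      fun x => (hmax x).ne')
  -- The truncation `max x π` avoids dividing by zero and makes the second term vanish for `x ≤ π`,
  -- where `π / x` does not bind.
  let G : StieltjesFunction ℝ :=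
    { toFun := fun x => max (F x) (1 - π / max x π)
      mono' := fun x y hxy => max_le_max (F.mono hxy) (by
        have := hmax x
        gcongr)
      right_continuous' := fun x => (F.right_continuous x).max hcont.continuousWithinAt }
  have hG : ∀ x, G x = max (F x) (1 - π / max x π) := fun x => rfl
  have hGbot : Tendsto G atBot (𝓝 0) := by
    refine hbot.congr' ?_
    filter_upwards [eventually_le_atBot 0] with x hx
    rw [hG, max_eq_right (hx.trans hπ.le), div_self hπ.ne', sub_self,
      max_eq_left (F.mono.le_of_tendsto hbot x)]
  have hGtop : Tendsto G atTop (𝓝 1) := by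
    refine tendsto_of_tendsto_of_tendsto_of_le_of_le htop tendsto_const_nhds
      (fun x => le_max_left _ _) (fun x => max_le (F.mono.ge_of_tendsto htop x) ?_)
    have : 0 ≤ π / max x π := div_nonneg hπ.le (hmax x).le
    linarith
  obtain ⟨P, hP⟩ := exists_ccdf_eq G hGbot hGtop
  refine ⟨P, fun x hx => ?_⟩
  rcases hx.2.eq_or_lt with rfl | hx1
  · rw [ccdf_of_one_le P le_rfl, ccdf_of_one_le P₀ le_rfl, min_eq_left (by positivity)]
  rw [hP x ⟨hx.1.le, hx1⟩, hG, hF x]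
  have hF0 : 0 ≤ F x := F.mono.le_of_tendsto hbot x
  rcases le_total x π with h | h
  · have h1 : 1 ≤ π / x := (one_le_div hx.1).2 h
    rw [max_eq_right h, div_self hπ.ne', sub_self, max_eq_left hF0, min_eq_left (by linarith)]
  · rw [max_eq_left h]
    rcases le_total (F x) (1 - π / x) with h' | h'
    · rw [max_eq_right h', min_eq_right (by linarith)]
      ring
    · rw [max_eq_left h', min_eq_left (by linarith)]

lemma exists_ccdf_eq_zero : ∃ P : ProbabilityMeasure I, ∀ x ∈ Ioc (0 : ℝ) 1, ccdf P x = 0 := by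
  refine ⟨⟨Measure.dirac 0, inferInstance⟩, fun x hx => ?_⟩
  simp [ccdf, Measure.real, hx.1.le]

lemma exists_isorevenue (P₀ : ProbabilityMeasure I) {π : ℝ} (hπ : 0 ≤ π) :
    ∃ P : ProbabilityMeasure I, ∀ x ∈ Ioc (0 : ℝ) 1, ccdf P x = min (ccdf P₀ x) (π / x) := by
  rcases hπ.eq_or_lt with rfl | hπ
  -- For `π = 0` the cut removes all mass above `0`, leaving the Dirac mass there.
  · obtain ⟨P, hP⟩ := exists_ccdf_eq_zero
    exact ⟨P, fun x hx => by rw [hP x hx, zero_div, min_eq_right (ccdf_nonneg _ _)]⟩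
  · exact exists_ccdf_eq_min P₀ hπ

/-- Test the robust constraint at the distribution with survival function `min (ccdf P₀ x) (π / x)`.
-/
lemma le_adjustedRevenue {P₀ : ProbabilityMeasure I} {τ k : ℝ} {M : (I → I) × (I → ℝ)}
    (h : (M, k) ∈ satisficingFeasible P₀ τ) {π : ℝ} (hπ : 0 ≤ π) :
    τ ≤ π + k * isoDist P₀ π := by
  obtain ⟨P, hP⟩ := exists_isorevenue P₀ hπ
  have h1 : expectedRevenue P M.2 ≤ π := by
    refine expectedRevenue_le h.1 P fun x hx => ?_
    rcases hx.1.eq_or_lt with rfl | hx0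
    · simpa using hπ
    · rw [hP x ⟨hx0, hx.2⟩]
      calc x * min (ccdf P₀ x) (π / x) ≤ x * (π / x) :=
            mul_le_mul_of_nonneg_left (min_le_right _ _) hx.1
        _ = π := mul_div_cancel₀ _ hx0.ne'
  have h2 : wassersteinDist P P₀ = isoDist P₀ π := by
    refine intervalIntegral.integral_congr_ae (ae_of_all _ fun x hx => ?_)
    rw [uIoc_of_le zero_le_one] at hx
    rw [hP x hx, abs_sub_comm, abs_of_nonneg (sub_nonneg.2 (min_le_left _ _))]
    rcases le_total (ccdf P₀ x) (π / x) with h | h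
    · rw [min_eq_left h, max_eq_right (by linarith), sub_self]
    · rw [min_eq_right h, max_eq_left (by linarith)]
  have h3 := h.2.2 P
  simp only [h2] at h3
  linarith

/-! ### Randomised posted prices -/

/-- A randomised posted price with price density `g x / x`, as a direct mechanism. -/
lemma exists_mechanism_of_density {g : ℝ → ℝ} {k : ℝ} (hg : Measurable g) (hg0 : ∀ x, 0 ≤ g x)
    (hgk : ∀ x, g x ≤ k) (hint : IntervalIntegrable (fun x => g x / x) volume 0 1)
    (hone : ∫ x in (0 : ℝ)..1, g x / x ≤ 1) :
    ∃ M ∈ mechanisms, ∀ P : ProbabilityMeasure I,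
      expectedRevenue P M.2 = ∫ x in (0 : ℝ)..1, g x * ccdf P x := by
  have hgabs : ∀ x, |g x| ≤ k := fun x => by rw [abs_of_nonneg (hg0 x)]; exact hgk x
  have hk : 0 ≤ k := (hg0 0).trans (hgk 0)
  have hgi : ∀ a b, IntervalIntegrable g volume a b := intervalIntegrable_of_abs_le hg hgabs
  have hqi : ∀ v w : I, IntervalIntegrable (fun x => g x / x) volume v w := fun v w =>
    hint.mono_set (by
      rw [uIcc_of_le zero_le_one]
      exact uIcc_subset_Icc v.2 w.2)
  have hq : ∀ v : I, ∫ x in (0 : ℝ)..v, g x / x ∈ Icc (0 : ℝ) 1 := by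
    intro v
    have h1 : 0 ≤ ∫ x in (0 : ℝ)..v, g x / x :=
      intervalIntegral.integral_nonneg v.2.1 fun x hx => div_nonneg (hg0 x) hx.1
    have h2 : 0 ≤ ∫ x in (v : ℝ)..1, g x / x :=
      intervalIntegral.integral_nonneg v.2.2 fun x hx => div_nonneg (hg0 x) (v.2.1.trans hx.1)
    have h3 := intervalIntegral.integral_add_adjacent_intervals (hqi 0 v) (hqi v 1)
    simp only [Icc.coe_zero, Icc.coe_one] at h3
    exact ⟨h1, by linarith⟩
  let q : I → I := fun v => ⟨∫ x in (0 : ℝ)..v, g x / x, hq v⟩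
  let m : I → ℝ := fun v => ∫ x in (0 : ℝ)..v, g x
  have hIC : ∀ v w : I, (q w : ℝ) * v - m w ≤ (q v : ℝ) * v - m v := by
    intro v w
    have h1 : (q v : ℝ) - q w = ∫ x in (w : ℝ)..v, g x / x :=
      intervalIntegral.integral_interval_sub_left (hqi 0 v) (hqi 0 w)
    have h2 : m v - m w = ∫ x in (w : ℝ)..v, g x :=
      intervalIntegral.integral_interval_sub_left (hgi 0 v) (hgi 0 w)
    -- Compare `g x` with `g x * (v / x)`: the factor is at least `1` below `v` and at most `1`
    -- above, where the orientation of the integral reverses the inequality.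
    suffices m v - m w ≤ ((q v : ℝ) - q w) * v by linarith
    rw [h1, h2, ← intervalIntegral.integral_mul_const]
    rcases le_total w v with h | h
    · refine intervalIntegral.integral_mono_on_of_le_Ioo h (hgi _ _) ((hqi w v).mul_const _)
        fun x hx => ?_
      have hx0 : 0 < x := w.2.1.trans_lt hx.1
      rw [div_mul_eq_mul_div, le_div_iff₀ hx0]
      exact mul_le_mul_of_nonneg_left hx.2.le (hg0 x)
    · rw [intervalIntegral.integral_symm, intervalIntegral.integral_symm (v : ℝ), neg_le_neg_iff]
      refine intervalIntegral.integral_mono_on_of_le_Ioo h ((hqi v w).mul_const _) (hgi _ _)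
        fun x hx => ?_
      have hx0 : 0 < x := v.2.1.trans_lt hx.1
      rw [div_mul_eq_mul_div, div_le_iff₀ hx0]
      exact mul_le_mul_of_nonneg_left hx.1.le (hg0 x)
  refine ⟨(q, m), ⟨fun v => ?_, hIC⟩, fun P => ?_⟩
  -- Type `0` gets and pays nothing, so imitating it yields individual rationality.
  · have := hIC v 0
    simpa [q, m] using this
  -- A domain independent of `v` allows Fubini; the inner integral over `v` is then `g x * ccdf P
  -- x`.
  have hm : ∀ v : I, m v = ∫ x in (0 : ℝ)..1, {x : ℝ | x < v}.indicator g x := by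
    intro v
    simp only [m]
    rw [intervalIntegral.integral_of_le v.2.1, intervalIntegral.integral_of_le zero_le_one,
      setIntegral_indicator (show MeasurableSet {x : ℝ | x < v} from measurableSet_Iio),
      integral_Ioc_eq_integral_Ioo]
    congr 2
    ext x
    simp only [mem_Ioo, mem_inter_iff, mem_Ioc, mem_ofPred_eq]
    exact ⟨fun h => ⟨⟨h.1, h.2.le.trans v.2.2⟩, h.2⟩, fun h => ⟨h.1.1, h.2⟩⟩
  have hmeas : MeasurableSet {z : ℝ × I | z.1 < (z.2 : ℝ)} :=
    measurableSet_lt measurable_fst (measurable_subtype_coe.comp measurable_snd)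
  have hswap := intervalIntegral_integral_swap (μ := (P : Measure I)) (a := 0) (b := 1)
    (f := fun (x : ℝ) (v : I) => {x : ℝ | x < v}.indicator g x) (by
      have heq : (Function.uncurry fun (x : ℝ) (v : I) => {x : ℝ | x < v}.indicator g x) =
          {z : ℝ × I | z.1 < (z.2 : ℝ)}.indicator fun z => g z.1 := by
        ext z
        simp [indicator, Function.uncurry]
      rw [heq]
      have : IsFiniteMeasure (volume.restrict (uIoc (0 : ℝ) 1)) :=
        ⟨by simp⟩
      refine Integrable.indicator ?_ hmeas
      exact Integrable.of_bound (hg.comp measurable_fst).aestronglyMeasurable k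
        (ae_of_all _ fun z => hgabs z.1))
  simp only [expectedRevenue, hm]
  rw [← hswap]
  refine intervalIntegral.integral_congr fun x _ => ?_
  have : (fun v : I => {x : ℝ | x < v}.indicator g x) =
      {v : I | x < (v : ℝ)}.indicator fun _ => g x := by
    ext v
    simp [indicator]
  simp only [this]
  rw [integral_indicator_const _ (measurableSet_lt_coe x), smul_eq_mul, mul_comm]
  rfl

lemma intervalIntegrable_mul_ccdf {g : ℝ → ℝ} {k : ℝ} (hg : Measurable g)
    (hgk : ∀ x, |g x| ≤ k) (P : ProbabilityMeasure I) :
    IntervalIntegrable (fun x => g x * ccdf P x) volume 0 1 := by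
  refine intervalIntegrable_of_abs_le (hg.mul (ccdf_measurable P)) (C := k) (fun x => ?_) 0 1
  rw [Pi.mul_apply, abs_mul, abs_of_nonneg (ccdf_nonneg P x)]
  exact (mul_le_of_le_one_right (abs_nonneg _) (ccdf_le_one P x)).trans (hgk x)

/-- The bound `g ≤ k` reduces the robust constraint for all `P` to a single inequality at `P₀`. -/
lemma integral_mul_ccdf_le {g : ℝ → ℝ} {k : ℝ} (hg : Measurable g) (hg0 : ∀ x, 0 ≤ g x)
    (hgk : ∀ x, g x ≤ k) (P P₀ : ProbabilityMeasure I) :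
    ∫ x in (0 : ℝ)..1, g x * ccdf P₀ x ≤
      (∫ x in (0 : ℝ)..1, g x * ccdf P x) + k * wassersteinDist P P₀ := by
  have hgabs : ∀ x, |g x| ≤ k := fun x => by rw [abs_of_nonneg (hg0 x)]; exact hgk x
  have hd : IntervalIntegrable (fun x => k * |ccdf P x - ccdf P₀ x|) volume 0 1 := by
    refine (intervalIntegrable_of_abs_le ((ccdf_measurable P).sub (ccdf_measurable P₀)).abs
      (C := 1) (fun x => ?_) 0 1).const_mul k
    rw [abs_abs, Pi.sub_apply, abs_le]
    constructor <;> linarith [ccdf_nonneg P x, ccdf_nonneg P₀ x, ccdf_le_one P x, ccdf_le_one P₀ x]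
  rw [wassersteinDist, ← intervalIntegral.integral_const_mul,
    ← intervalIntegral.integral_add (intervalIntegrable_mul_ccdf hg hgabs P) hd]
  refine intervalIntegral.integral_mono_on zero_le_one (intervalIntegrable_mul_ccdf hg hgabs P₀)
    ((intervalIntegrable_mul_ccdf hg hgabs P).add hd) fun x _ => ?_
  have h1 : g x * (ccdf P₀ x - ccdf P x) ≤ g x * |ccdf P x - ccdf P₀ x| :=
    mul_le_mul_of_nonneg_left (by rw [abs_sub_comm]; exact le_abs_self _) (hg0 x)
  have h2 := mul_le_mul_of_nonneg_right (hgk x) (abs_nonneg (ccdf P x - ccdf P₀ x))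
  linarith

/-! ### The continuous knapsack problem -/

/-- The measure with density `k / x` on `(0, 1]`. -/
noncomputable def reciprocalMeasure (k : ℝ) : Measure ℝ :=
  (volume.restrict (Ioc 0 1)).withDensity fun x => ENNReal.ofReal (k / x)

lemma reciprocalMeasure_apply (k : ℝ) {A : Set ℝ} (hA : MeasurableSet A) :
    reciprocalMeasure k A =
      ∫⁻ x in Ioc 0 1, ENNReal.ofReal (A.indicator (fun x => k / x) x) := by
  rw [reciprocalMeasure, withDensity_apply _ hA, ← lintegral_indicator hA]
  refine lintegral_congr fun x => ?_
  by_cases hx : x ∈ A <;> simp [hx]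

lemma integrable_and_integral_of_reciprocalMeasure_ne_top {k : ℝ} (hk : 0 ≤ k) {A : Set ℝ}
    (hA : MeasurableSet A) (hfin : reciprocalMeasure k A ≠ ⊤) :
    IntervalIntegrable (A.indicator fun x => k / x) volume 0 1 ∧
      ∫ x in (0 : ℝ)..1, A.indicator (fun x => k / x) x = (reciprocalMeasure k A).toReal := by
  have hmeas : Measurable (A.indicator fun x : ℝ => k / x) :=
    (measurable_const.div measurable_id).indicator hA
  have hnn : 0 ≤ᵐ[volume.restrict (Ioc (0 : ℝ) 1)] A.indicator fun x : ℝ => k / x := by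
    refine (ae_restrict_iff' measurableSet_Ioc).2 (ae_of_all _ fun x hx => ?_)
    exact indicator_apply_nonneg fun _ => div_nonneg hk hx.1.le
  rw [reciprocalMeasure_apply k hA] at hfin ⊢
  constructor
  · rw [intervalIntegrable_iff_integrableOn_Ioc_of_le zero_le_one]
    exact (lintegral_ofReal_ne_top_iff_integrable hmeas.aestronglyMeasurable hnn).1 hfin
  · rw [intervalIntegral.integral_of_le zero_le_one]
    exact integral_eq_lintegral_of_nonneg_ae hnn hmeas.aestronglyMeasurable

lemma reciprocalMeasure_Ioc_zero {k c : ℝ} (hk : 0 < k) (hc : 0 < c) :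
    reciprocalMeasure k (Ioc 0 c) = ⊤ := by
  by_contra hfin
  have h := (integrable_and_integral_of_reciprocalMeasure_ne_top hk.le measurableSet_Ioc hfin).1
  have hd : 0 < min c 1 := lt_min hc one_pos
  have h1 : IntervalIntegrable (fun x : ℝ => k⁻¹ * (Ioc 0 c).indicator (fun x => k / x) x)
      volume 0 (min c 1) := (h.mono_set (by
        rw [uIcc_of_le zero_le_one, uIcc_of_le hd.le]
        exact Icc_subset_Icc_right (min_le_right _ _))).const_mul _
  have h2 : IntervalIntegrable (fun x : ℝ => x⁻¹) volume 0 (min c 1) := by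
    refine h1.congr fun x hx => ?_
    rw [uIoc_of_le hd.le] at hx
    rw [indicator_of_mem (show x ∈ Ioc 0 c from ⟨hx.1, hx.2.trans (min_le_left _ _)⟩)]
    field_simp
  rw [intervalIntegrable_inv_iff] at h2
  rcases h2 with h2 | h2
  · exact hd.ne h2
  · exact h2 left_mem_uIcc

lemma reciprocalMeasure_Ici_lt_top (k : ℝ) {c : ℝ} (hc : 0 < c) :
    reciprocalMeasure k (Ici c) < ⊤ := by
  rw [reciprocalMeasure_apply k measurableSet_Ici]
  have hle : ∀ x, ENNReal.ofReal ((Ici c).indicator (fun x => k / x) x) ≤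
      ENNReal.ofReal (|k| / c) := by
    intro x
    refine ENNReal.ofReal_le_ofReal ?_
    by_cases hx : x ∈ Ici c
    · rw [indicator_of_mem hx]
      have hx' : c ≤ x := hx
      calc k / x ≤ |k| / x := div_le_div_of_nonneg_right (le_abs_self k) (hc.le.trans hx')
        _ ≤ |k| / c := by gcongr
    · rw [indicator_of_notMem hx]
      positivity
  refine (lintegral_mono hle).trans_lt ?_
  simp

/-- The solution of the continuous knapsack problem of maximising `∫ g · ccdf` subject to
`0 ≤ g ≤ k` and `∫ g x / x ≤ 1`, together with its multiplier. -/
lemma exists_knapsack_solution (P : ProbabilityMeasure I) {k x₀ : ℝ} (hk : 0 < k)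
    (hx₀ : 0 < x₀) (hpos : 0 < ccdf P x₀) :
    ∃ π ∈ Icc 0 (maxPostedRevenue P), ∃ g : ℝ → ℝ, Measurable g ∧ (∀ x, 0 ≤ g x) ∧
      (∀ x, g x ≤ k) ∧ IntervalIntegrable (fun x => g x / x) volume 0 1 ∧
      (∫ x in (0 : ℝ)..1, g x / x = 1) ∧
      ∀ x ∈ Ioc (0 : ℝ) 1, g x * ccdf P x = k * max (ccdf P x - π / x) 0 + π * (g x / x) := by
  let h : ℝ → ℝ := fun x => x * ccdf P x
  have hh : Measurable h := measurable_id.mul (ccdf_measurable P)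
  let ν := reciprocalMeasure k
  -- Thresholds at which setting `g = k` strictly above the threshold stays within the budget; the
  -- infimum is the multiplier.
  let S : Set ℝ := {π | 0 ≤ π ∧ ν {x | π < h x} ≤ 1}
  have hA : ∀ π, MeasurableSet {x | π < h x} := fun π => measurableSet_lt measurable_const hh
  have hB : ∀ π, MeasurableSet {x | π ≤ h x} := fun π => measurableSet_le measurable_const hh
  have hmem : maxPostedRevenue P ∈ S := by
    refine ⟨maxPostedRevenue_nonneg P, ?_⟩
    have : ν {x | maxPostedRevenue P < h x} = 0 := by
      rw [show ν = reciprocalMeasure k from rfl, reciprocalMeasure_apply k (hA _)]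
      refine (setLIntegral_congr_fun measurableSet_Ioc fun x hx => ?_).trans lintegral_zero
      rw [indicator_of_notMem, ENNReal.ofReal_zero]
      exact not_lt.2 (mul_ccdf_le_maxPostedRevenue P ⟨hx.1.le, hx.2⟩)
    simp [this]
  have hbdd : BddBelow S := ⟨0, fun π hπ => hπ.1⟩
  let π := sInf S
  have hπ0 : 0 ≤ π := le_csInf ⟨_, hmem⟩ fun _ hx => hx.1
  have hup : ∀ ρ, π < ρ → ν {x | ρ < h x} ≤ 1 := by
    intro ρ hρ
    obtain ⟨ξ, hξ, hξρ⟩ := exists_lt_of_csInf_lt ⟨_, hmem⟩ hρ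
    exact (measure_mono fun x (hx : ρ < h x) => hξρ.trans hx).trans hξ.2
  have hA1 : ν {x | π < h x} ≤ 1 := by
    have hU : {x | π < h x} = ⋃ n : ℕ, {x | π + 1 / ((n : ℝ) + 1) < h x} := by
      ext x
      simp only [mem_iUnion, mem_ofPred_eq]
      constructor
      · intro hx
        obtain ⟨n, hn⟩ := exists_nat_one_div_lt (sub_pos.2 hx)
        exact ⟨n, by linarith⟩
      · rintro ⟨n, hn⟩
        have : (0 : ℝ) < 1 / ((n : ℝ) + 1) := by positivity
        linarith
    have hmono : Monotone fun n : ℕ => {x | π + 1 / ((n : ℝ) + 1) < h x} := by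
      intro n m hnm x hx
      have := Nat.one_div_le_one_div (α := ℝ) hnm
      simp only [mem_ofPred_eq] at hx ⊢
      linarith
    rw [hU, hmono.measure_iUnion]
    refine iSup_le fun n => hup _ ?_
    have : (0 : ℝ) < 1 / ((n : ℝ) + 1) := by positivity
    linarith
  -- At threshold `0` the set would contain `(0, x₀]`, which has infinite mass.
  have hπpos : 0 < π := by
    refine hπ0.lt_of_ne fun h0 => ?_
    have hsub : Ioc 0 x₀ ⊆ {x | π < h x} := by
      intro x hx
      simp only [mem_ofPred_eq, ← h0]
      exact mul_pos hx.1 (hpos.trans_le (ccdf_antitone P hx.2))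
    have := (measure_mono hsub).trans hA1
    rw [show ν = reciprocalMeasure k from rfl, reciprocalMeasure_Ioc_zero hk hx₀] at this
    simp at this
  -- Since `ccdf P ≤ 1`, positive `x` with `h x ≥ ρ` satisfy `x ≥ ρ`. Finiteness is needed for
  -- continuity from above.
  have hfin : ∀ ρ, 0 < ρ → ν {x | ρ ≤ h x} < ⊤ := by
    intro ρ hρ
    have hsub : {x | ρ ≤ h x} ⊆ Ici ρ ∪ Iic 0 := by
      intro x (hx : ρ ≤ h x)
      rcases le_total x 0 with hx0 | hx0
      · exact Or.inr hx0
      · exact Or.inl (hx.trans (mul_le_of_le_one_right hx0 (ccdf_le_one P x)))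
    have hzero : ν (Iic 0) = 0 := by
      rw [show ν = reciprocalMeasure k from rfl, reciprocalMeasure_apply k measurableSet_Iic]
      refine (setLIntegral_congr_fun measurableSet_Ioc fun x hx => ?_).trans lintegral_zero
      rw [indicator_of_notMem (by simpa using hx.1), ENNReal.ofReal_zero]
    refine (measure_mono hsub).trans_lt ((measure_union_le _ _).trans_lt ?_)
    rw [hzero, add_zero]
    exact reciprocalMeasure_Ici_lt_top k hρ
  have hlow : ∀ ρ, 0 ≤ ρ → ρ < π → 1 ≤ ν {x | ρ < h x} := by
    intro ρ hρ0 hρ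
    by_contra hlt
    exact absurd (csInf_le hbdd ⟨hρ0, (not_le.1 hlt).le⟩) (not_le.2 hρ)
  have hB1 : 1 ≤ ν {x | π ≤ h x} := by
    -- Increases to `π` from `π / 2`, so it stays positive and `hfin` applies.
    let r : ℕ → ℝ := fun n => π - (π / 2) * (1 / ((n : ℝ) + 1))
    have hr0 : ∀ n, 0 < r n := by
      intro n
      have h1 : 1 / ((n : ℝ) + 1) ≤ 1 := by
        rw [div_le_one (by positivity)]
        have : (0 : ℝ) ≤ n := n.cast_nonneg
        linarith
      have : (π / 2) * (1 / ((n : ℝ) + 1)) ≤ π / 2 := mul_le_of_le_one_right (by linarith) h1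
      simp only [r]
      linarith
    have hrπ : ∀ n, r n < π := by
      intro n
      have : 0 < (π / 2) * (1 / ((n : ℝ) + 1)) := by positivity
      simp only [r]
      linarith
    have hrm : Monotone r := by
      intro n m hnm
      have := mul_le_mul_of_nonneg_left (Nat.one_div_le_one_div (α := ℝ) hnm)
        (show 0 ≤ π / 2 by linarith)
      simp only [r]
      linarith
    have hrt : Tendsto r atTop (𝓝 π) := by
      have := (tendsto_one_div_add_atTop_nhds_zero_nat (𝕜 := ℝ)).const_mul (π / 2)
      simpa [r] using this.const_sub π
    have hI : {x | π ≤ h x} = ⋂ n : ℕ, {x | r n < h x} := by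
      ext x
      simp only [mem_iInter, mem_ofPred_eq]
      exact ⟨fun hx n => (hrπ n).trans_le hx,
        fun hx => le_of_tendsto' hrt fun n => (hx n).le⟩
    have hanti : Antitone fun n : ℕ => {x | r n < h x} :=
      fun n m hnm x hx => (hrm hnm).trans_lt hx
    rw [hI, hanti.measure_iInter (fun n => (hA _).nullMeasurableSet)
      ⟨0, ((measure_mono fun x (hx : r 0 < h x) => hx.le).trans_lt (hfin _ (hr0 0))).ne⟩]
    exact le_iInf fun n => hlow _ (hr0 n).le (hrπ n)
  have hAfin : ν {x | π < h x} ≠ ⊤ := (hA1.trans_lt ENNReal.one_lt_top).ne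
  have hBfin : ν {x | π ≤ h x} ≠ ⊤ := (hfin π hπpos).ne
  obtain ⟨hAi, hAe⟩ := integrable_and_integral_of_reciprocalMeasure_ne_top hk.le (hA π) hAfin
  obtain ⟨hBi, hBe⟩ := integrable_and_integral_of_reciprocalMeasure_ne_top hk.le (hB π) hBfin
  let a := (ν {x | π < h x}).toReal
  let b := (ν {x | π ≤ h x}).toReal
  have ha : a ≤ 1 := by simpa using ENNReal.toReal_mono ENNReal.one_ne_top hA1
  have hb : 1 ≤ b := by simpa using ENNReal.toReal_mono hBfin hB1
  -- The tie set `h = π` may have positive mass; filling the fraction `θ` of it exhausts the budget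
  -- exactly.
  obtain ⟨θ, hθ0, hθ1, hθ⟩ : ∃ θ : ℝ, 0 ≤ θ ∧ θ ≤ 1 ∧ (1 - θ) * a + θ * b = 1 := by
    rcases (ha.trans hb).eq_or_lt with hab | hab
    · exact ⟨0, le_rfl, zero_le_one, by linarith⟩
    · have hba : 0 < b - a := sub_pos.2 hab
      refine ⟨(1 - a) / (b - a), div_nonneg (by linarith) hba.le,
        (div_le_one hba).2 (by linarith), ?_⟩
      field_simp
      ring
  let g : ℝ → ℝ := fun x => (1 - θ) * {x | π < h x}.indicator (fun _ => k) x +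
    θ * {x | π ≤ h x}.indicator (fun _ => k) x
  have hgt : ∀ x, π < h x → g x = k := by
    intro x hx
    simp only [g]
    rw [indicator_of_mem (show x ∈ {x | π < h x} from hx),
      indicator_of_mem (show x ∈ {x | π ≤ h x} from hx.le)]
    ring
  have hgeq : ∀ x, π = h x → g x = θ * k := by
    intro x hx
    simp only [g]
    rw [indicator_of_notMem (show x ∉ {x | π < h x} from not_lt.2 hx.ge),
      indicator_of_mem (show x ∈ {x | π ≤ h x} from hx.le)]
    ring
  have hglt : ∀ x, h x < π → g x = 0 := by
    intro x hx
    simp only [g]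
    rw [indicator_of_notMem (show x ∉ {x | π < h x} from not_lt.2 hx.le),
      indicator_of_notMem (show x ∉ {x | π ≤ h x} from not_le.2 hx)]
    ring
  have hgdiv : (fun x => g x / x) = fun x =>
      (1 - θ) * {x | π < h x}.indicator (fun x => k / x) x +
        θ * {x | π ≤ h x}.indicator (fun x => k / x) x := by
    ext x
    simp only [g, indicator_apply]
    split_ifs <;> ring
  refine ⟨π, ⟨hπ0, csInf_le hbdd hmem⟩, g, ?_, ?_, ?_, ?_, ?_, ?_⟩
  · exact ((measurable_const.indicator (hA π)).const_mul _).add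
      ((measurable_const.indicator (hB π)).const_mul _)
  · intro x
    rcases lt_trichotomy π (h x) with hx | hx | hx
    · rw [hgt x hx]; exact hk.le
    · rw [hgeq x hx]; positivity
    · rw [hglt x hx]
  · intro x
    rcases lt_trichotomy π (h x) with hx | hx | hx
    · rw [hgt x hx]
    · rw [hgeq x hx]; exact mul_le_of_le_one_left hk.le hθ1
    · rw [hglt x hx]; exact hk.le
  · rw [hgdiv]
    exact (hAi.const_mul _).add (hBi.const_mul _)
  · rw [hgdiv, intervalIntegral.integral_add (hAi.const_mul _) (hBi.const_mul _),
      intervalIntegral.integral_const_mul, intervalIntegral.integral_const_mul, hAe, hBe]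
    exact hθ
  -- Complementary slackness, pointwise: `g = k` above the threshold, `g = 0` below, and on ties
  -- both sides equal `g x * (π / x)`.
  · intro x hx
    have hx0 := hx.1
    rcases lt_trichotomy π (h x) with hxπ | hxπ | hxπ
    · have : π / x ≤ ccdf P x := by
        rw [div_le_iff₀ hx0, mul_comm]; exact hxπ.le
      rw [hgt x hxπ, max_eq_left (by linarith)]
      ring
    · have : ccdf P x = π / x := by
        rw [eq_div_iff hx0.ne', mul_comm]; exact hxπ.symm
      rw [this, sub_self, max_self]
      ring
    · have : ccdf P x ≤ π / x := by
        rw [le_div_iff₀ hx0, mul_comm]; exact hxπ.le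
      rw [hglt x hxπ, max_eq_right (by linarith)]
      ring

/-! ### Equivalence of the two problems -/

lemma exists_ccdf_pos_of_isoDist_zero_pos {P : ProbabilityMeasure I} (h : 0 < isoDist P 0) :
    ∃ x, 0 < x ∧ 0 < ccdf P x := by
  by_contra! hcon
  have : isoDist P 0 = 0 := by
    refine (intervalIntegral.integral_congr_ae (g := fun _ => (0 : ℝ))
      (ae_of_all _ fun x hx => ?_)).trans (by simp)
    rw [uIoc_of_le zero_le_one] at hx
    simpa using hcon x hx.1
  exact h.ne' this

/-- Whenever the reduced constraint holds, a randomised posted price satisfies the robust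
constraint. -/
lemma exists_satisficing_mechanism {P₀ : ProbabilityMeasure I} {τ k : ℝ} (hτ : 0 < τ) (hk : 0 < k)
    (h : ∀ π ∈ Icc 0 (maxPostedRevenue P₀), τ ≤ π + k * isoDist P₀ π) :
    ∃ M, (M, k) ∈ satisficingFeasible P₀ τ := by
  -- At `π = 0`, the target `τ > 0` forces `P₀` to charge positive values, as the knapsack solution
  -- requires.
  have h0 := h 0 (left_mem_Icc.2 (maxPostedRevenue_nonneg P₀))
  have hd : 0 < isoDist P₀ 0 := by
    rw [zero_add] at h0
    exact pos_of_mul_pos_right (hτ.trans_le h0) hk.le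
  obtain ⟨x₀, hx₀, hpos⟩ := exists_ccdf_pos_of_isoDist_zero_pos hd
  obtain ⟨π, hπ, g, hg, hg0, hgk, hgi, hone, hgeq⟩ := exists_knapsack_solution P₀ hk hx₀ hpos
  obtain ⟨M, hM, hrev⟩ := exists_mechanism_of_density hg hg0 hgk hgi hone.le
  refine ⟨M, hM, hk, fun P => ?_⟩
  -- Absence of a duality gap: integrate the slackness identity and use that the budget is
  -- exhausted.
  have hval : ∫ x in (0 : ℝ)..1, g x * ccdf P₀ x = k * isoDist P₀ π + π := by
    have hmi : IntervalIntegrable (fun x => max (ccdf P₀ x - π / x) 0) volume 0 1 := by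
      refine (intervalIntegrable_const (c := (1 : ℝ))).mono_fun
        (isoDist_integrand_measurable P₀ π).aestronglyMeasurable ?_
      refine (ae_restrict_iff' measurableSet_uIoc).2 (ae_of_all _ fun x hx => ?_)
      rw [uIoc_of_le zero_le_one] at hx
      have h1 : 0 ≤ π / x := div_nonneg hπ.1 hx.1.le
      simp only
      rw [Real.norm_of_nonneg (le_max_right _ _), norm_one]
      exact max_le (by linarith [ccdf_le_one P₀ x]) zero_le_one
    calc ∫ x in (0 : ℝ)..1, g x * ccdf P₀ x
        = ∫ x in (0 : ℝ)..1, (k * max (ccdf P₀ x - π / x) 0 + π * (g x / x)) := by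
          refine intervalIntegral.integral_congr_ae (ae_of_all _ fun x hx => ?_)
          rw [uIoc_of_le zero_le_one] at hx
          exact hgeq x hx
      _ = _ := by
          rw [intervalIntegral.integral_add (hmi.const_mul _) (hgi.const_mul _),
            intervalIntegral.integral_const_mul, intervalIntegral.integral_const_mul, hone,
            mul_one]
          rfl
  have h1 := integral_mul_ccdf_le hg hg0 hgk P P₀
  rw [hval, ← hrev P] at h1
  have h2 := h π hπ
  simp only
  linarith

lemma exists_satisficingFeasible_iff {P₀ : ProbabilityMeasure I} {τ : ℝ} (hτ : 0 < τ) (k : ℝ) :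
    (∃ M, (M, k) ∈ satisficingFeasible P₀ τ) ↔ k ∈ reducedFeasible P₀ τ := by
  have hleast := isLeast_minAdjustedRevenue P₀ k
  constructor
  · rintro ⟨M, hM⟩
    obtain ⟨π, hπ, heq⟩ := hleast.1
    exact ⟨hM.2.1, heq ▸ le_adjustedRevenue hM hπ.1⟩
  · rintro ⟨hk, hle⟩
    exact exists_satisficing_mechanism hτ hk fun π hπ =>
      hle.trans (hleast.2 (mem_image_of_mem _ hπ))

end RobustScreening

theorem proposition2 (P₀ : ProbabilityMeasure I) (τ : ℝ) (hτ : 0 < τ) :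
    -- the maximum defining `Π₀` and the minimum in the reduced constraint are attained
    IsGreatest (range (postedRevenue P₀)) (maxPostedRevenue P₀) ∧
    (∀ k : ℝ, 0 < k → IsLeast (adjustedRevenues P₀ k) (minAdjustedRevenue P₀ k)) ∧
    -- both problems admit the same values of `k`
    (∀ k : ℝ, (∃ M : (I → I) × (I → ℝ), (M, k) ∈ satisficingFeasible P₀ τ) ↔
      k ∈ reducedFeasible P₀ τ) ∧
    -- they have the same optimal value
    satisficingValue P₀ τ = reducedValue P₀ τ ∧
    -- and the same optimal values of `k`
    (∀ k : ℝ, (∃ M : (I → I) × (I → ℝ), (M, k) ∈ satisficingFeasible P₀ τ ∧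
        ∀ s ∈ satisficingFeasible P₀ τ, k ≤ s.2) ↔
      IsLeast (reducedFeasible P₀ τ) k) := by
  have hiff := exists_satisficingFeasible_iff (P₀ := P₀) hτ
  refine ⟨isGreatest_maxPostedRevenue P₀, fun k _ => isLeast_minAdjustedRevenue P₀ k, hiff,
    ?_, fun k => ?_⟩
  · apply le_antisymm
    · refine le_iInf₂ fun k hk => ?_
      obtain ⟨M, hM⟩ := (hiff k).2 hk
      exact iInf₂_le_of_le (M, k) hM le_rfl
    · refine le_iInf₂ fun s hs => ?_
      exact iInf₂_le s.2 ((hiff s.2).1 ⟨s.1, hs⟩)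
  · constructor
    · rintro ⟨M, hM, hmin⟩
      refine ⟨(hiff k).1 ⟨M, hM⟩, fun l hl => ?_⟩
      obtain ⟨N, hN⟩ := (hiff l).2 hl
      exact hmin _ hN
    · rintro ⟨hk, hmin⟩
      obtain ⟨M, hM⟩ := (hiff k).2 hk
      exact ⟨M, hM, fun s hs => hmin ((hiff s.2).1 ⟨s.1, hs⟩)⟩
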